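/- Theorem 3. Let $\lambda,\mu>0$, $\rho=\lambda/\mu$ and $\epsilon\in[0,1)$. Let $\mathcal U$ and $\mathcal V$ be finite alphabets of the same size. A source generates i.i.d. symbols $U_1,U_2,\dots$ with values in $\mathcal U$ and a common non-deterministic law (no symbol has probability $1$); the symbol $U_j$ is generated at time $j/\lambda$. A memoryless erasure channel EC$(\epsilon)$ with input alphabet $\mathcal V$ is used at the times $i/\mu$, $i=1,2,\dots$; each input is erased (output $?$) with probability $\epsilon$, independently of the other uses and of the source, and is otherwise received correctly and instantaneously. There is no feedback. A coding scheme $\mathcal C=(f_i,g_i)_{i\ge1}$ consists of encoders $f_i:\mathcal U^{\lfloor i\rho\rfloor}\to\mathcal V$, where $f_i(U_1,\dots,U_{\lfloor i\rho\rfloor})$ is the input of the $i$-th channel use, and of decoders $g_i$ which map the first $i$ channel outputs either to the declaration of an erasure or to a pair $(\hat u,j)$ with $\hat u\in\mathcal U$, $1\le j\le\lfloor i\rho\rfloor$, where $\hat u$ is an estimate of $U_j$. The scheme has zero error if almost surely every estimate that is put out is correct. Its instantaneous age is $\Delta_{\epsilon,\mathcal C}(t)=t-u(t)$, where $u(t)$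 is the generation time of the most recently generated symbol that has been decoded at a channel use up to time $t$, and $u(t)=0$ if there is none. The scheme has average age $\Delta_{\epsilon,\mathcal C}\in[-\infty,\infty]$ if almost surely $\frac1\tau\int_0^\tau\Delta_{\epsilon,\mathcal C}(t)\,\mathrm dt\to\Delta_{\epsilon,\mathcal C}$ as $\tau\to\infty$. The optimal average age $\Delta_\epsilon$ is the infimum of $\Delta_{\epsilon,\mathcal C}$ over all zero-error coding schemes $\mathcal C$ that have an average age. Then: - if $\rho$ is irrational, $\displaystyle \Delta_\epsilon=\frac1{2\lambda}+\frac{1+\epsilon}{2\mu(1-\epsilon)}$; - if $\rho=\frac ml$ with $m,l\in\mathbb N$, $l\ne0$ and $\gcd(m,l)=1$, then $\displaystyle \Delta_\epsilon=\frac{l-1}{2l\lambda}+\frac{1+\epsilon}{2\mu(1-\epsilon)}$. Moreover, the infimum is attained by some zero-error coding scheme, and for every zero-error coding scheme $\mathcal C$, whether or not it has an average age, almost surely $\liminf_{\tau\to\infty}\frac1\tau\int_0^\tau\Delta_{\epsilon,\mathcal C}(t)\,\mathrm dt\ge\Delta_\epsilon$. -/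

import Mathlib

open Filter Topology MeasureTheory ProbabilityTheory

noncomputable section

/-- The number `⌊i T_c / T_s⌋ = ⌊i ρ⌋` of source symbols generated up to (and including) the
instant `i T_c` of the `i`-th channel use, where `ρ = T_c / T_s` is the utilization. -/
def numGenerated (ρ : ℝ) (i : ℕ) : ℕ := ⌊(i : ℝ) * ρ⌋₊

/-- A coding scheme `(f_i, g_i)_{i ≥ 1}` without feedback, for the source alphabet `U` and the
channel-input alphabet `V`. At the `i`-th channel use the encoder maps all source symbols generated
so far to one channel input; the decoder maps the first `i` channel outputs (`none` is the erasure
symbol `?`) to either `none` (it declares an erasure), or to an estimate of a source symbol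
together with the index of that symbol. Tuples are indexed from `0`: the entry `j` of a tuple of
source symbols is the `(j+1)`-st symbol, the entry `k` of a tuple of channel outputs is the
output of the `(k+1)`-st channel use. The members `enc 0` and `dec 0` are never used. -/
structure CodingScheme (U V : Type*) (ρ : ℝ) where
  enc : (i : ℕ) → (Fin (numGenerated ρ i) → U) → V
  dec : (i : ℕ) → (Fin i → Option V) → Option (U × Fin (numGenerated ρ i))

/-- The sample space: the sequence of source symbols (`ω.1 j` is the `(j+1)`-st symbol) and the
erasure pattern (`ω.2 k = true` if and only if the `(k+1)`-st channel use is erased). -/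
abbrev Sample (U : Type*) : Type _ := (ℕ → U) × (ℕ → Bool)

/-- The law of the system: the source symbols are i.i.d. with law `p`, the channel uses are erased
independently with probability `ε`, and erasures are independent of the source. -/
def systemLaw {U : Type*} [MeasurableSpace U] (p : Measure U) (ε : unitInterval) :
    Measure (Sample U) :=
  (Measure.infinitePi (fun _ : ℕ => p)).prod
    (Measure.infinitePi (fun _ : ℕ => bernoulliMeasure true false ε))

namespace CodingScheme

variable {U V : Type*} {ρ : ℝ}

/-- The first `i` outputs of the erasure channel. -/
def received (C : CodingScheme U V ρ) (ω : Sample U) (i : ℕ) : Fin i → Option V :=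
  fun k => if ω.2 k = true then none else some (C.enc ((k : ℕ) + 1) (fun j => ω.1 (j : ℕ)))

/-- What the decoder puts out at the `i`-th channel use. -/
def output (C : CodingScheme U V ρ) (ω : Sample U) (i : ℕ) :
    Option (U × Fin (numGenerated ρ i)) :=
  C.dec i (C.received ω i)

/-- The index (counted from `1`) of the source symbol decoded at the `i`-th channel use, and `0`
if an erasure is declared. -/
def decodedIndex (C : CodingScheme U V ρ) (ω : Sample U) (i : ℕ) : ℕ :=
  match C.output ω i with
  | none => 0
  | some (_, j) => (j : ℕ) + 1

/-- The index (counted from `1`) of the freshest source symbol decoded during the channel uses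
`1, …, n`, and `0` if there is none. -/
def freshestIndex (C : CodingScheme U V ρ) (ω : Sample U) (n : ℕ) : ℕ :=
  (Finset.Icc 1 n).sup (C.decodedIndex ω)

/-- Almost surely every symbol that the decoder puts out is the true one. -/
def ZeroError [MeasurableSpace U] (C : CodingScheme U V ρ) (p : Measure U) (ε : unitInterval) :
    Prop :=
  ∀ᵐ ω ∂(systemLaw p ε), ∀ i : ℕ, 1 ≤ i →
    ∀ (u : U) (j : Fin (numGenerated ρ i)), C.output ω i = some (u, j) → u = ω.1 j

/-- The instantaneous age `t - u(t)`. The `i`-th channel use takes place at time `i / μ`, hence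
`⌊t μ⌋` of them have taken place by time `t`; the `j`-th source symbol is generated at time
`j / λ`. Before the first symbol is decoded, `u(t) = 0`. -/
def age {lam mu : ℝ} (C : CodingScheme U V (lam / mu)) (ω : Sample U) (t : ℝ) : ℝ :=
  t - (C.freshestIndex ω ⌊t * mu⌋₊ : ℝ) / lam

/-- The time average `(1/τ) ∫₀^τ Δ(t) dt` of the age. -/
def timeAverage {lam mu : ℝ} (C : CodingScheme U V (lam / mu)) (ω : Sample U) (τ : ℝ) : ℝ :=
  1 / τ * ∫ t in (0 : ℝ)..τ, C.age ω t

/-- The average age of the scheme exists and is `a` (possibly `⊤`): almost surely,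
`(1/τ) ∫₀^τ Δ(t) dt` tends to `a` as `τ → ∞`. -/
def HasAverageAge [MeasurableSpace U] {lam mu : ℝ} (C : CodingScheme U V (lam / mu))
    (p : Measure U) (ε : unitInterval) (a : EReal) : Prop :=
  ∀ᵐ ω ∂(systemLaw p ε), Tendsto (fun τ : ℝ => (C.timeAverage ω τ : EReal)) atTop (𝓝 a)

end CodingScheme

/-- The optimal average age: the infimum of the average ages of all coding schemes with zero error
probability. -/
def optimalAverageAge (U V : Type*) [MeasurableSpace U] (p : Measure U) (ε : unitInterval)
    (lam mu : ℝ) : EReal :=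
  sInf {a : EReal | ∃ C : CodingScheme U V (lam / mu), C.ZeroError p ε ∧ C.HasAverageAge p ε a}

end

/-! The problem reduces path by path to the erasure pattern. With the pattern fixed, the decoder
sees only symbols generated by the last non-erased use. An estimate of a later symbol is independent
of that symbol, which is not deterministic, so it is wrong with positive probability unless it is
almost never put out (`measure_output_eq_zero`). Hence almost surely no zero-error scheme beats
`freshestAge`. Sending the freshest symbol uncoded attains this age, since the alphabets have the
same size.

It remains to average `freshestAge`. At the channel uses it equals `erasureReward`: it grows by 1/μ
at each erasure and is otherwise reset to the delay {nρ}/λ. Summing its recursion leaves a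
martingale whose variance grows linearly, so the mean reward is ε/(μ(1-ε)) plus the mean delay
(`ae_tendsto_average_erasureReward`). The linear growth between uses adds 1/(2μ).

The mean of {nρ} is (l-1)/(2l) for ρ = m/l by periodicity. For irrational ρ it is 1/2, by comparing
blocks of length q with the rotation by a close fraction p/q. -/

/-! ### Means of the fractional parts of multiples of ρ -/

lemma sum_range_natCast_zmod {M : Type*} [AddCommMonoid M] (q : ℕ) [NeZero q] (g : ZMod q → M) :
    ∑ j ∈ Finset.range q, g (j : ZMod q) = ∑ z : ZMod q, g z := by
  refine Finset.sum_nbij' (fun j => (j : ZMod q)) ZMod.val ?_ ?_ ?_ ?_ ?_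
  · simp
  · intro z _
    simpa using ZMod.val_lt z
  · intro j hj
    exact ZMod.val_cast_of_lt (by simpa using hj)
  · intro z _
    simp
  · simp

lemma sum_zmod_val (q : ℕ) [NeZero q] :
    ∑ z : ZMod q, (z.val : ℝ) / q = ((q : ℝ) - 1) / 2 := by
  have hq : (q : ℝ) ≠ 0 := by exact_mod_cast NeZero.ne q
  rw [← sum_range_natCast_zmod q (fun z => (z.val : ℝ) / q)]
  have h1 : ∀ j ∈ Finset.range q, (((j : ZMod q).val : ℕ) : ℝ) / q = (j : ℝ) / q := by
    intro j hj
    rw [ZMod.val_cast_of_lt (by simpa using hj)]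
  rw [Finset.sum_congr rfl h1, ← Finset.sum_div]
  have h2 : (∑ j ∈ Finset.range q, (j : ℝ)) * 2 = q * (q - 1) := by
    have := Finset.sum_range_id_mul_two q
    have h3 : ((q - 1 : ℕ) : ℝ) = (q : ℝ) - 1 := by
      rw [Nat.cast_sub (NeZero.one_le)]; simp
    rw [← h3, ← Nat.cast_mul, ← this]
    push_cast
    rfl
  field_simp
  linarith

lemma fract_intCast_div_natCast (q : ℕ) [NeZero q] (z : ℤ) :
    Int.fract ((z : ℝ) / (q : ℝ)) = ((z : ZMod q).val : ℝ) / q := by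
  rw [Int.fract_div_intCast_eq_div_intCast_mod]
  congr 1
  rw [← ZMod.val_intCast]
  simp

/-- As p is a unit mod q, the map j ↦ a + jp permutes the residues. -/
lemma sum_zmod_affine {M : Type*} [AddCommMonoid M] (q : ℕ) [NeZero q] (p a : ℤ)
    (hpq : IsCoprime p (q : ℤ)) (g : ZMod q → M) :
    ∑ j ∈ Finset.range q, g ((a : ZMod q) + (j : ZMod q) * (p : ZMod q)) = ∑ z : ZMod q, g z := by
  have hu : IsUnit (p : ZMod q) := by
    obtain ⟨u, v, huv⟩ := hpq
    refine IsUnit.of_mul_eq_one (u : ZMod q) ?_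
    have := congrArg (fun z : ℤ => (z : ZMod q)) huv
    simp only [Int.cast_add, Int.cast_mul, Int.cast_natCast, ZMod.natCast_self, mul_zero,
      add_zero, Int.cast_one] at this
    rw [mul_comm]; exact this
  rw [sum_range_natCast_zmod q (fun z => g ((a : ZMod q) + z * (p : ZMod q)))]
  exact Equiv.sum_comp ((Units.mulRight hu.unit).trans (Equiv.addLeft (a : ZMod q))) g

/-- Exact average over a full period of a rational rotation started at a lattice point. -/
lemma sum_fract_rational (q : ℕ) [NeZero q] (p a : ℤ) (hpq : IsCoprime p (q : ℤ)) :
    ∑ j ∈ Finset.range q, Int.fract (((a + j * p : ℤ) : ℝ) / q) = ((q : ℝ) - 1) / 2 := by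
  rw [← sum_zmod_val q, ← sum_zmod_affine q p a hpq (fun z => (z.val : ℝ) / q)]
  refine Finset.sum_congr rfl fun j _ => ?_
  rw [fract_intCast_div_natCast]
  push_cast
  rfl

lemma fract_add_le_of_nonneg (y d : ℝ) (hd : 0 ≤ d) : Int.fract (y + d) ≤ Int.fract y + d :=
  (Int.fract_add_le y d).trans (by
    have : Int.fract d ≤ d := by
      have : (0 : ℝ) ≤ ⌊d⌋ := by exact_mod_cast Int.floor_nonneg.2 hd
      linarith [Int.self_sub_floor d]
    linarith)

/-- Rounding x down to a multiple of 1/q costs at most 1/q per term, hence at most 1 on top of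
(q-1)/2. -/
lemma sum_fract_add_rational_le (q : ℕ) [NeZero q] (p : ℤ) (hpq : IsCoprime p (q : ℤ)) (x : ℝ) :
    ∑ j ∈ Finset.range q, Int.fract (x + j * ((p : ℝ) / q)) ≤ (q : ℝ) / 2 + 1 / 2 := by
  have hq : (0 : ℝ) < q := by exact_mod_cast NeZero.pos q
  have h : ∀ j ∈ Finset.range q, Int.fract (x + j * ((p : ℝ) / q)) ≤
      Int.fract (((⌊x * q⌋ + j * p : ℤ) : ℝ) / q) + 1 / q := by
    intro j _
    have e : x + j * ((p : ℝ) / q) =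
        ((⌊x * q⌋ + j * p : ℤ) : ℝ) / q + Int.fract (x * q) / q := by
      rw [← Int.self_sub_floor]
      push_cast
      field_simp
      ring
    rw [e]
    refine (fract_add_le_of_nonneg _ _ (div_nonneg (Int.fract_nonneg _) hq.le)).trans ?_
    gcongr
    exact (Int.fract_lt_one _).le
  refine (Finset.sum_le_sum h).trans ?_
  rw [Finset.sum_add_distrib, sum_fract_rational q p _ hpq]
  simp only [Finset.sum_const, Finset.card_range, nsmul_eq_mul]
  field_simp
  linarith

/-- Replacing ρ by p/q shifts each term by at most q|δ|, so the block by at most q²|δ| ≤ 1. Only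
nonnegative shifts are controlled, because the fractional part jumps down at integers; this is why
the bound is one-sided. -/
lemma sum_fract_block_le (q : ℕ) [NeZero q] (p : ℤ) (hpq : IsCoprime p (q : ℤ)) (ρ x : ℝ)
    (h : |ρ - p / q| * (q * q) ≤ 1) :
    ∑ j ∈ Finset.range q, Int.fract (x + j * ρ) ≤ (q : ℝ) / 2 + 2 := by
  have hq : (0 : ℝ) < q := by exact_mod_cast NeZero.pos q
  set δ := ρ - p / q with hδ
  have key : ∀ y : ℝ, ∀ d : ℕ → ℝ, (∀ j ∈ Finset.range q, 0 ≤ d j ∧ d j ≤ |δ| * q) →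
      (∀ j : ℕ, x + j * ρ = y + j * ((p : ℝ) / q) + d j) →
      ∑ j ∈ Finset.range q, Int.fract (x + j * ρ) ≤ (q : ℝ) / 2 + 2 := by
    intro y d hd he
    have h1 : ∀ j ∈ Finset.range q, Int.fract (x + j * ρ) ≤
        Int.fract (y + j * ((p : ℝ) / q)) + |δ| * q := by
      intro j hj
      rw [he j]
      exact (fract_add_le_of_nonneg _ _ (hd j hj).1).trans (by linarith [(hd j hj).2])
    refine (Finset.sum_le_sum h1).trans ?_
    rw [Finset.sum_add_distrib]
    have := sum_fract_add_rational_le q p hpq y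
    simp only [Finset.sum_const, Finset.card_range, nsmul_eq_mul]
    nlinarith
  rcases le_total 0 δ with h0 | h0
  · refine key x (fun j => j * δ) ?_ ?_
    · intro j hj
      have hj' : (j : ℝ) ≤ q := by exact_mod_cast (Finset.mem_range.1 hj).le
      refine ⟨by positivity, ?_⟩
      rw [abs_of_nonneg h0, mul_comm]
      gcongr
    · intro j
      rw [hδ]; ring
  -- For δ ≤ 0 the base point is moved down by q|δ|, which makes all shifts nonnegative.
  · refine key (x + q * δ) (fun j => (q - j) * -δ) ?_ ?_
    · intro j hj
      have hj' : (j : ℝ) ≤ q := by exact_mod_cast (Finset.mem_range.1 hj).le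
      have hj0 : (0 : ℝ) ≤ j := j.cast_nonneg
      rw [abs_of_nonpos h0]
      constructor
      · nlinarith
      · nlinarith
    · intro j
      rw [hδ]; ring

/-- Dirichlet's theorem supplies the quality of the approximation. The denominator exceeds Q because
fractions with smaller denominators keep a positive distance from ρ; the factor 2 below makes the
contradiction strict. -/
lemma Irrational.exists_coprime_approx {ρ : ℝ} (hρ : Irrational ρ) (Q : ℕ) :
    ∃ (p : ℤ) (q : ℕ), Q < q ∧ IsCoprime p (q : ℤ) ∧ |ρ - p / q| * (q * q) ≤ 1 := by
  have h1 := hρ.eventually_forall_le_dist_cast_rat_of_den_le Q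
  have h2 : Tendsto (fun n : ℕ => 2 * (1 / ((n : ℝ) + 1))) atTop (𝓝 0) := by
    simpa using (tendsto_one_div_add_atTop_nhds_zero_nat (𝕜 := ℝ)).const_mul 2
  obtain ⟨n, hn, hn0⟩ := ((h2.eventually h1).and (eventually_gt_atTop 0)).exists
  obtain ⟨r, hr, hrn⟩ := Real.exists_rat_abs_sub_le_and_den_le ρ hn0
  have hd : (1 : ℝ) ≤ r.den := by exact_mod_cast r.den_pos
  have hn1 : (0 : ℝ) < (n : ℝ) + 1 := by positivity
  have hcast : (r : ℝ) = (r.num : ℝ) / (r.den : ℝ) := by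
    exact_mod_cast (Rat.num_div_den r).symm
  by_cases hQ : Q < r.den
  · refine ⟨r.num, r.den, hQ, ?_, ?_⟩
    · rw [Int.isCoprime_iff_nat_coprime]
      exact r.reduced
    · rw [← hcast]
      have hrn' : (r.den : ℝ) ≤ n := by exact_mod_cast hrn
      calc |ρ - r| * (r.den * r.den) ≤ 1 / ((n + 1) * r.den) * (r.den * r.den) := by gcongr
        _ = r.den / (n + 1) := by field_simp
        _ ≤ 1 := by rw [div_le_one hn1]; linarith
  · exfalso
    have hlt : 2 * ((1 : ℝ) / (n + 1)) ≤ 1 / ((n + 1) * r.den) :=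
      (hn r (not_lt.1 hQ)).trans (by rwa [Real.dist_eq])
    have hle : (1 : ℝ) / ((n + 1) * r.den) ≤ 1 / (n + 1) := by
      apply one_div_le_one_div_of_le hn1
      nlinarith
    have : (0 : ℝ) < 1 / (n + 1) := by positivity
    linarith

/-- Blocks of length q are stripped off the end; the fewer than q terms left over contribute at most
q, which is negligible against N. -/
lemma tendsto_average_of_blocks (f : ℕ → ℝ) (L : ℝ) (hf : ∀ n, |f n - L| ≤ 1)
    (h : ∀ η : ℝ, 0 < η → ∃ q : ℕ, 0 < q ∧
      ∀ n₀, |∑ j ∈ Finset.range q, (f (n₀ + j) - L)| ≤ η * q) :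
    Tendsto (fun N : ℕ => (∑ n ∈ Finset.range N, f n) / N) atTop (𝓝 L) := by
  rw [Metric.tendsto_atTop]
  intro η hη
  obtain ⟨q, hq, hblock⟩ := h (η / 2) (half_pos hη)
  have bound : ∀ N : ℕ, |∑ n ∈ Finset.range N, (f n - L)| ≤ η / 2 * N + q := by
    intro N
    induction N using Nat.strong_induction_on with
    | _ N ih =>
      rcases lt_or_ge N q with hN | hN
      · have h1 : |∑ n ∈ Finset.range N, (f n - L)| ≤ N := by
          refine (Finset.abs_sum_le_sum_abs _ _).trans ?_
          refine (Finset.sum_le_sum fun n _ => hf n).trans ?_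
          simp
        have h2 : (N : ℝ) ≤ q := by exact_mod_cast hN.le
        have h3 : 0 ≤ η / 2 * N := by positivity
        linarith
      · obtain ⟨M, rfl⟩ := Nat.exists_eq_add_of_le' hN
        rw [Finset.sum_range_add]
        have h1 := ih M (by omega)
        have h2 := hblock M
        push_cast
        refine (abs_add_le _ _).trans ?_
        linarith
  obtain ⟨N₀, hN₀⟩ := exists_nat_gt (q / (η / 2))
  refine ⟨N₀, fun N hN => ?_⟩
  have hNr : (N₀ : ℝ) ≤ N := by exact_mod_cast hN
  have hNq : q < η / 2 * N := by
    rw [div_lt_iff₀ (half_pos hη)] at hN₀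
    nlinarith
  have hN0 : (0 : ℝ) < N := by
    have : (0 : ℝ) ≤ q / (η / 2) := by positivity
    linarith
  have e : (∑ n ∈ Finset.range N, f n) / N - L = (∑ n ∈ Finset.range N, (f n - L)) / N := by
    rw [Finset.sum_sub_distrib]
    simp only [Finset.sum_const, Finset.card_range, nsmul_eq_mul]
    field_simp
  rw [Real.dist_eq, e, abs_div, abs_of_pos hN0, div_lt_iff₀ hN0]
  linarith [bound N]

/-- The fractional parts of the multiples of an irrational number have mean `1 / 2`. -/
theorem tendsto_average_fract_of_irrational {ρ : ℝ} (hρ : Irrational ρ) :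
    Tendsto (fun N : ℕ => (∑ n ∈ Finset.range N, Int.fract ((n : ℝ) * ρ)) / N) atTop
      (𝓝 (1 / 2)) := by
  refine tendsto_average_of_blocks _ _ ?_ ?_
  · intro n
    have h1 := Int.fract_nonneg ((n : ℝ) * ρ)
    have h2 := Int.fract_lt_one ((n : ℝ) * ρ)
    rw [abs_le]
    constructor <;> linarith
  · intro η hη
    -- A block sum exceeds q/2 by at most 2 and falls short of it by at most 2 + 1.
    obtain ⟨Q, hQ⟩ := exists_nat_gt (3 / η)
    obtain ⟨p, q, hQq, hpq, hap⟩ := hρ.exists_coprime_approx Q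
    have hq : 0 < q := by omega
    have : NeZero q := ⟨hq.ne'⟩
    have hηq : 3 < η * q := by
      have : (Q : ℝ) < q := by exact_mod_cast hQq
      rw [div_lt_iff₀ hη] at hQ
      nlinarith
    refine ⟨q, hq, fun n₀ => ?_⟩
    have hup := sum_fract_block_le q p hpq ρ (n₀ * ρ) hap
    -- The lower bound is the upper bound for -ρ, as {-y} = 1 - {y} for non-integral y. The only
    -- integral multiple is the zeroth, which can occur only at j = 0 and costs 1.
    have hlo := sum_fract_block_le q (-p) hpq.neg_left (-ρ) (-(n₀ * ρ)) (by
      have : -ρ - ((-p : ℤ) : ℝ) / q = -(ρ - p / q) := by push_cast; ring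
      rwa [this, abs_neg])
    have e1 : ∀ j ∈ Finset.range q, Int.fract (((n₀ + j : ℕ) : ℝ) * ρ) =
        Int.fract (n₀ * ρ + j * ρ) := by
      intro j _
      push_cast
      rw [add_mul]
    have e2 : ∑ j ∈ Finset.range q, (1 - Int.fract (((n₀ + j : ℕ) : ℝ) * ρ)) - 1 ≤
        ∑ j ∈ Finset.range q, Int.fract (-(n₀ * ρ) + j * -ρ) := by
      have hterm : ∀ j ∈ Finset.range q, (1 - Int.fract (((n₀ + j : ℕ) : ℝ) * ρ)) -
          (if j = 0 then 1 else 0) ≤ Int.fract (-(n₀ * ρ) + j * -ρ) := by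
        intro j hj
        split_ifs with h0
        · linarith [Int.fract_nonneg (((n₀ + j : ℕ) : ℝ) * ρ),
            Int.fract_nonneg (-(n₀ * ρ) + j * -ρ)]
        · have : -(n₀ * ρ) + j * -ρ = -(((n₀ + j : ℕ) : ℝ) * ρ) := by push_cast; ring
          rw [this, Int.fract_neg, sub_zero]
          intro hz
          rw [Int.fract_eq_zero_iff] at hz
          obtain ⟨z, hz⟩ := hz
          exact (hρ.natCast_mul (m := n₀ + j) (by omega)).ne_int z hz.symm
      have := Finset.sum_le_sum hterm
      rw [Finset.sum_sub_distrib, Finset.sum_ite_eq' (Finset.range q) 0,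
        if_pos (Finset.mem_range.2 hq)] at this
      exact this
    rw [Finset.sum_sub_distrib] at e2 ⊢
    rw [← Finset.sum_congr rfl e1] at hup
    simp only [Finset.sum_const, Finset.card_range, nsmul_eq_mul] at e2 ⊢
    rw [abs_le]
    constructor <;> linarith

/-- The mean of the fractional parts of the multiples of a reduced fraction. -/
theorem tendsto_average_fract_of_coprime {m l : ℕ} (hl : l ≠ 0) (hml : Nat.Coprime m l) :
    Tendsto (fun N : ℕ => (∑ n ∈ Finset.range N, Int.fract ((n : ℝ) * ((m : ℝ) / l))) / N) atTop
      (𝓝 (((l : ℝ) - 1) / (2 * l))) := by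
  have hl1 : (1 : ℝ) ≤ l := by exact_mod_cast Nat.one_le_iff_ne_zero.2 hl
  refine tendsto_average_of_blocks _ _ ?_ ?_
  · intro n
    have h1 := Int.fract_nonneg ((n : ℝ) * ((m : ℝ) / l))
    have h2 := Int.fract_lt_one ((n : ℝ) * ((m : ℝ) / l))
    have h3 : 0 ≤ ((l : ℝ) - 1) / (2 * l) := div_nonneg (by linarith) (by linarith)
    have h4 : ((l : ℝ) - 1) / (2 * l) ≤ 1 := by
      rw [div_le_one (by linarith)]; linarith
    rw [abs_le]
    constructor <;> linarith
  · intro η hη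
    have : NeZero l := ⟨hl⟩
    refine ⟨l, Nat.pos_of_ne_zero hl, fun n₀ => ?_⟩
    have h := sum_fract_rational l m (n₀ * m) (Nat.isCoprime_iff_coprime.2 hml)
    have e : ∀ j ∈ Finset.range l, Int.fract (((n₀ + j : ℕ) : ℝ) * ((m : ℝ) / l)) =
        Int.fract (((n₀ * m + j * m : ℤ) : ℝ) / l) := by
      intro j _
      push_cast
      congr 1
      ring
    rw [Finset.sum_sub_distrib, Finset.sum_congr rfl e, h]
    simp only [Finset.sum_const, Finset.card_range, nsmul_eq_mul]
    have : ((l : ℝ) - 1) / 2 - l * ((l - 1) / (2 * l)) = 0 := by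
      field_simp
      ring
    rw [this, abs_zero]
    positivity

/-! ### Functions of finitely many coordinates of an i.i.d. sequence -/

lemma exists_restrict_of_dependsOn {α β : Type*} [Nonempty β] {n : ℕ} {f : (ℕ → α) → β}
    (hf : DependsOn f (Set.Iio n)) :
    ∃ g : ((i : Finset.range n) → α) → β, ∀ ω, f ω = g (fun i => ω i) := by
  have hf' : DependsOn f (Finset.range n : Set ℕ) := hf.mono (by intro i; simp)
  obtain ⟨g, hg⟩ := dependsOn_iff_exists_comp.1 hf'
  exact ⟨g, fun ω => congrFun hg ω⟩

section FinitePrefix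

variable {α β : Type*} [Finite α] [MeasurableSpace α] [MeasurableSingletonClass α]
  [MeasurableSpace β] [Nonempty β] {n : ℕ}

lemma measurable_of_dependsOn {f : (ℕ → α) → β} (hf : DependsOn f (Set.Iio n)) :
    Measurable f := by
  obtain ⟨g, hg⟩ := exists_restrict_of_dependsOn hf
  obtain rfl : f = fun ω => g (fun i => ω i) := funext hg
  exact (measurable_of_finite g).comp (measurable_pi_lambda _ fun i => measurable_pi_apply _)

lemma indepFun_eval_of_dependsOn (p : Measure α) [IsProbabilityMeasure p] {f : (ℕ → α) → β}
    (hf : DependsOn f (Set.Iio n)) :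
    IndepFun (fun ω : ℕ → α => ω n) f (Measure.infinitePi fun _ : ℕ => p) := by
  obtain ⟨g, hg⟩ := exists_restrict_of_dependsOn hf
  obtain rfl : f = fun ω => g (fun i => ω i) := funext hg
  have hind := iIndepFun_infinitePi (P := fun _ : ℕ => p) (X := fun _ x => x)
    (fun _ => measurable_id)
  have h := hind.indepFun_finset {n} (Finset.range n) (by simp) (fun i => measurable_pi_apply i)
  exact h.comp (φ := fun x : ((i : ({n} : Finset ℕ)) → α) => x ⟨n, by simp⟩) (ψ := g)
    (measurable_pi_apply _) (measurable_of_finite g)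

lemma integrable_of_dependsOn (P : Measure (ℕ → α)) [IsFiniteMeasure P] {f : (ℕ → α) → ℝ}
    (hf : DependsOn f (Set.Iio n)) : Integrable f P := by
  obtain ⟨g, hg⟩ := exists_restrict_of_dependsOn hf
  obtain ⟨C, hC⟩ := (Set.finite_range fun x => ‖g x‖).bddAbove
  refine Integrable.of_bound (measurable_of_dependsOn hf).aestronglyMeasurable C
    (Eventually.of_forall fun ω => ?_)
  rw [hg]
  exact hC ⟨_, rfl⟩

lemma integral_eval_mul_of_dependsOn (p : Measure α) [IsProbabilityMeasure p] (h : α → ℝ)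
    {f : (ℕ → α) → ℝ} (hf : DependsOn f (Set.Iio n)) :
    ∫ ω, h (ω n) * f ω ∂(Measure.infinitePi fun _ : ℕ => p) =
      (∫ x, h x ∂p) * ∫ ω, f ω ∂(Measure.infinitePi fun _ : ℕ => p) := by
  have hm : Measurable h := measurable_of_finite h
  have hi := (indepFun_eval_of_dependsOn p hf).comp hm measurable_id
  have := hi.integral_fun_mul_eq_mul_integral
    (hm.comp (measurable_pi_apply n)).aestronglyMeasurable
    (measurable_of_dependsOn hf).aestronglyMeasurable
  simp only [Function.comp_apply, id] at this
  rw [this]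
  congr 1
  have hmap := (measurePreserving_eval_infinitePi (fun _ : ℕ => p) n).map_eq
  conv_rhs => rw [← hmap]
  rw [integral_map (measurable_pi_apply n).aemeasurable hm.aestronglyMeasurable]

end FinitePrefix

/-! ### Almost sure convergence from second moments -/

/-- By Tonelli the sum of the squares has finite mean, so it is almost surely finite and its terms
tend to 0. -/
lemma ae_tendsto_zero_of_summable_integral_sq {Ω : Type*} [MeasurableSpace Ω] {P : Measure Ω}
    {Y : ℕ → Ω → ℝ} (hm : ∀ k, Measurable (Y k)) (hi : ∀ k, Integrable (fun ω => Y k ω ^ 2) P)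
    (hs : Summable fun k => ∫ ω, Y k ω ^ 2 ∂P) :
    ∀ᵐ ω ∂P, Tendsto (fun k => Y k ω) atTop (𝓝 0) := by
  have hmeas : ∀ k, Measurable fun ω => ENNReal.ofReal (Y k ω ^ 2) := fun k =>
    ((hm k).pow_const 2).ennreal_ofReal
  have hfin : ∫⁻ ω, ∑' k, ENNReal.ofReal (Y k ω ^ 2) ∂P ≠ ⊤ := by
    rw [lintegral_tsum fun k => (hmeas k).aemeasurable]
    have : ∀ k, ∫⁻ ω, ENNReal.ofReal (Y k ω ^ 2) ∂P = ENNReal.ofReal (∫ ω, Y k ω ^ 2 ∂P) :=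
      fun k => (ofReal_integral_eq_lintegral_ofReal (hi k)
        (Eventually.of_forall fun ω => sq_nonneg _)).symm
    simp_rw [this]
    exact hs.tsum_ofReal_ne_top
  filter_upwards [ae_lt_top (Measurable.tsum hmeas) hfin] with ω hω
  have h1 := ENNReal.tendsto_atTop_zero_of_tsum_ne_top hω.ne
  have h2 : Tendsto (fun k => Y k ω ^ 2) atTop (𝓝 0) := by
    have := (ENNReal.tendsto_toReal ENNReal.zero_ne_top).comp h1
    simpa [Function.comp_def, ENNReal.toReal_ofReal (sq_nonneg _)] using this
  have h3 : Tendsto (fun k => |Y k ω|) atTop (𝓝 0) := by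
    simpa [Function.comp_def, Real.sqrt_sq_eq_abs] using
      (Real.continuous_sqrt.tendsto 0).comp h2
  exact (tendsto_zero_iff_abs_tendsto_zero _).2 h3

/-- Convergence of averages of nonnegative terms follows from convergence along the squares. -/
lemma tendsto_average_of_tendsto_squares {X : ℕ → ℝ} (hX : ∀ n, 0 ≤ X n) {L : ℝ}
    (h : Tendsto (fun k : ℕ => (∑ n ∈ Finset.range ((k + 1) ^ 2), X n) / ((k + 1 : ℕ) ^ 2 : ℕ))
      atTop (𝓝 L)) :
    Tendsto (fun N : ℕ => (∑ n ∈ Finset.range N, X n) / N) atTop (𝓝 L) := by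
  refine tendsto_div_of_monotone_of_exists_subseq_tendsto_div
    (fun N => ∑ n ∈ Finset.range N, X n) L ?_ fun a ha => ⟨fun k => (k + 1) ^ 2, ?_, ?_, ?_⟩
  · exact monotone_nat_of_le_succ fun N => by
      rw [Finset.sum_range_succ]
      linarith [hX N]
  -- With m = k + 1, (m+1)² ≤ am² follows from 2m + 1 ≤ 3m ≤ (a-1)m².
  · obtain ⟨K, hK⟩ := exists_nat_gt (3 / (a - 1))
    filter_upwards [eventually_ge_atTop K] with k hk
    have hk' : (K : ℝ) ≤ k := by exact_mod_cast hk
    have h1 : 3 < (a - 1) * (k + 1) := by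
      rw [div_lt_iff₀ (by linarith)] at hK
      nlinarith
    push_cast
    nlinarith
  · exact (tendsto_pow_atTop (by norm_num)).comp (tendsto_add_atTop_nat 1)
  · exact h

/-! ### Strong law for the erasure reward -/

/-- A reward which grows by `a` at each erasure, and is reset to `ψ n` by a non-erased use `n`. -/
def erasureReward (a : ℝ) (ψ : ℕ → ℝ) (b : ℕ → Bool) : ℕ → ℝ
  | 0 => ψ 0
  | n + 1 => if b n = true then erasureReward a ψ b n + a else ψ (n + 1)

/-- The law of the erasure pattern. -/
noncomputable abbrev erasureLaw (ε : unitInterval) : Measure (ℕ → Bool) :=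
  Measure.infinitePi fun _ : ℕ => bernoulliMeasure true false ε

section Reward

variable {a B : ℝ} {ψ : ℕ → ℝ} {ε : unitInterval}

lemma erasureReward_nonneg (ha : 0 ≤ a) (hψ : ∀ n, 0 ≤ ψ n) (b : ℕ → Bool) (n : ℕ) :
    0 ≤ erasureReward a ψ b n := by
  induction n with
  | zero => exact hψ 0
  | succ n ih =>
    rw [erasureReward]
    split_ifs
    · positivity
    · exact hψ _

lemma dependsOn_erasureReward (a : ℝ) (ψ : ℕ → ℝ) (n : ℕ) :
    DependsOn (fun b => erasureReward a ψ b n) (Set.Iio n) := by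
  induction n with
  | zero => intro b b' _; rfl
  | succ n ih =>
    intro b b' h
    have h1 := ih (fun i hi => h i (lt_trans hi (Nat.lt_succ_self n)))
    have h2 := h n (Nat.lt_succ_self n)
    simp only at h1
    simp only [erasureReward, h1, h2]

/-- The centered increments of the reward. -/
noncomputable def rewardNoise (a : ℝ) (ψ : ℕ → ℝ) (ε : unitInterval) (b : ℕ → Bool) (n : ℕ) : ℝ :=
  ((if b n = true then 1 else 0) - (ε : ℝ)) * (erasureReward a ψ b n + (a - ψ (n + 1)))

lemma erasureReward_succ (b : ℕ → Bool) (n : ℕ) :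
    erasureReward a ψ b (n + 1) = ε * (erasureReward a ψ b n + a) + (1 - ε) * ψ (n + 1) +
      rewardNoise a ψ ε b n := by
  rw [erasureReward, rewardNoise]
  split_ifs <;> ring

lemma dependsOn_rewardNoise (n : ℕ) :
    DependsOn (fun b => rewardNoise a ψ ε b n) (Set.Iio (n + 1)) := by
  intro b b' h
  have h1 := dependsOn_erasureReward a ψ n (fun i hi => h i (lt_trans hi (Nat.lt_succ_self n)))
  have h2 := h n (Nat.lt_succ_self n)
  simp only at h1
  simp only [rewardNoise, h1, h2]

lemma dependsOn_sum_rewardNoise (N : ℕ) :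
    DependsOn (fun b => ∑ n ∈ Finset.range N, rewardNoise a ψ ε b n) (Set.Iio N) := by
  intro b b' h
  refine Finset.sum_congr rfl fun n hn => dependsOn_rewardNoise n fun i hi => h i ?_
  simp only [Finset.mem_range, Set.mem_Iio] at *
  omega

/-- Summing the recursion puts the reward sum on both sides with weights 1 and ε; besides the noise
only boundary terms at 0 and N remain. -/
lemma sum_erasureReward (b : ℕ → Bool) (N : ℕ) :
    (1 - ε) * ∑ n ∈ Finset.range N, erasureReward a ψ b n =
      ε * a * N + (1 - ε) * (∑ n ∈ Finset.range N, ψ n + ψ N - ψ 0) + ψ 0 +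
      (∑ n ∈ Finset.range N, rewardNoise a ψ ε b n - erasureReward a ψ b N) := by
  induction N with
  | zero => simp [erasureReward]
  | succ N ih =>
    rw [Finset.sum_range_succ, Finset.sum_range_succ, Finset.sum_range_succ, mul_add, ih,
      erasureReward_succ (ε := ε)]
    push_cast
    ring

lemma integral_bernoulli_indicator (ε : unitInterval) :
    ∫ x, (if x = true then (1 : ℝ) else 0) ∂(bernoulliMeasure true false ε) = ε := by
  rw [integral_bernoulliMeasure]
  simp

lemma integral_bernoulli_centered (ε : unitInterval) :
    ∫ x, ((if x = true then (1 : ℝ) else 0) - (ε : ℝ)) ∂(bernoulliMeasure true false ε) = 0 := by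
  rw [integral_bernoulliMeasure]
  simp
  ring

lemma exists_integral_erasureReward_sq_le (hε : (ε : ℝ) < 1) (hψ : ∀ n, 0 ≤ ψ n)
    (hB : ∀ n, ψ n ≤ B) :
    ∃ C : ℝ, 0 ≤ C ∧ ∀ n, ∫ b, erasureReward a ψ b n ^ 2 ∂(erasureLaw ε) ≤ C := by
  have hr : (0 : ℝ) < 1 - ε := by linarith
  have hr0 : (0 : ℝ) ≤ ε := ε.2.1
  -- Chosen so that ε(x+a)² ≤ (1+ε)/2·x² + K; completing the square at x = 2εa/(1-ε) proves it.
  set K : ℝ := 2 * a ^ 2 / (1 - ε) + a ^ 2 with hK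
  have hK0 : 0 ≤ K := by positivity
  have hsq : ∀ n, ψ n ^ 2 ≤ B ^ 2 := fun n => pow_le_pow_left₀ (hψ n) (hB n) 2
  -- The fixed point of C ↦ (1+ε)/2·C + K + B², a contraction since ε < 1.
  refine ⟨2 * (K + B ^ 2) / (1 - ε), by positivity, fun n => ?_⟩
  induction n with
  | zero =>
    simp only [erasureReward, integral_const, probReal_univ, one_smul]
    rw [le_div_iff₀ hr]
    nlinarith [hsq 0, sq_nonneg (ψ 0)]
  | succ n ih =>
    have hdep : DependsOn (fun b => (erasureReward a ψ b n + a) ^ 2 - ψ (n + 1) ^ 2)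
        (Set.Iio n) := by
      intro b b' h
      have := dependsOn_erasureReward a ψ n h
      simp only at this
      simp only [this]
    have hdep2 : DependsOn (fun b => erasureReward a ψ b n ^ 2) (Set.Iio n) := by
      intro b b' h
      have := dependsOn_erasureReward a ψ n h
      simp only at this
      simp only [this]
    have hmul := integral_eval_mul_of_dependsOn (bernoulliMeasure true false ε)
      (fun x => if x = true then (1 : ℝ) else 0) hdep
    rw [integral_bernoulli_indicator] at hmul
    have hdep3 : DependsOn (fun b : ℕ → Bool => (if b n = true then (1 : ℝ) else 0) *
        ((erasureReward a ψ b n + a) ^ 2 - ψ (n + 1) ^ 2)) (Set.Iio (n + 1)) := by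
      intro b b' h
      have h1 := hdep (fun i hi => h i (lt_trans hi (Nat.lt_succ_self n)))
      have h2 := h n (Nat.lt_succ_self n)
      simp only at h1
      simp only [h1, h2]
    have hi1 := integrable_of_dependsOn (erasureLaw ε) hdep
    have hi2 := integrable_of_dependsOn (erasureLaw ε) hdep2
    have hi3 := integrable_of_dependsOn (erasureLaw ε) hdep3
    have e : ∀ b, erasureReward a ψ b (n + 1) ^ 2 = (if b n = true then (1 : ℝ) else 0) *
        ((erasureReward a ψ b n + a) ^ 2 - ψ (n + 1) ^ 2) + ψ (n + 1) ^ 2 := by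
      intro b
      rw [erasureReward]
      split_ifs <;> ring
    simp_rw [e]
    rw [integral_add hi3 (integrable_const _), hmul]
    have hle : ∫ b, (ε : ℝ) * ((erasureReward a ψ b n + a) ^ 2 - ψ (n + 1) ^ 2) ∂(erasureLaw ε) ≤
        ∫ b, ((1 + (ε : ℝ)) / 2 * erasureReward a ψ b n ^ 2 + K) ∂(erasureLaw ε) := by
      refine integral_mono (hi1.const_mul _) ((hi2.const_mul _).add (integrable_const _))
        fun b => ?_
      set x := erasureReward a ψ b n
      have hKr : (1 - ε) * K = 2 * a ^ 2 + (1 - ε) * a ^ 2 := by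
        rw [hK]; field_simp
      have h1 : 0 ≤ (ε : ℝ) * ψ (n + 1) ^ 2 := by positivity
      have h2 : (1 - (ε : ℝ)) * (ε * (x + a) ^ 2) ≤
          (1 - ε) * ((1 + ε) / 2 * x ^ 2 + K) := by
        rw [mul_add, hKr]
        nlinarith [sq_nonneg ((1 - ε) * x - 2 * ε * a), sq_nonneg a, hε, hr0,
          mul_nonneg hr0 hr.le, mul_nonneg (mul_nonneg hr.le hr.le) (sq_nonneg a),
          mul_nonneg hr.le (sq_nonneg a), mul_nonneg hr0 (sq_nonneg a),
          mul_nonneg (mul_nonneg hr.le hr0) (sq_nonneg a)]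
      have h3 := le_of_mul_le_mul_left h2 hr
      simp only
      linarith
    rw [integral_const_mul, integral_add (hi2.const_mul _) (integrable_const _),
      integral_const_mul] at hle
    simp only [integral_const, probReal_univ, one_smul] at hle ⊢
    have h5 : (1 + (ε : ℝ)) / 2 * ∫ b, erasureReward a ψ b n ^ 2 ∂(erasureLaw ε) ≤
        (1 + (ε : ℝ)) / 2 * (2 * (K + B ^ 2) / (1 - ε)) := by gcongr
    have h6 : (1 + (ε : ℝ)) / 2 * (2 * (K + B ^ 2) / (1 - ε)) + (K + B ^ 2) =
        2 * (K + B ^ 2) / (1 - ε) := by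
      field_simp
      ring
    linarith [hsq (n + 1)]

/-- Martingale orthogonality: the cross term has a centered factor in coordinate N, independent of
the rest, which depends on earlier coordinates only. -/
lemma integral_sum_rewardNoise_sq_succ (N : ℕ) :
    ∫ b, (∑ n ∈ Finset.range (N + 1), rewardNoise a ψ ε b n) ^ 2 ∂(erasureLaw ε) =
      ∫ b, (∑ n ∈ Finset.range N, rewardNoise a ψ ε b n) ^ 2 ∂(erasureLaw ε) +
        ∫ b, rewardNoise a ψ ε b N ^ 2 ∂(erasureLaw ε) := by
  have hX := dependsOn_erasureReward a ψ N
  have hM := dependsOn_sum_rewardNoise (a := a) (ψ := ψ) (ε := ε) N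
  have hdep : DependsOn (fun b => 2 * (erasureReward a ψ b N + (a - ψ (N + 1))) *
      ∑ n ∈ Finset.range N, rewardNoise a ψ ε b n) (Set.Iio N) := by
    intro b b' h
    have h1 := hX h
    have h2 := hM h
    simp only at h1 h2
    simp only [h1, h2]
  have hmul := integral_eval_mul_of_dependsOn (bernoulliMeasure true false ε)
    (fun x => (if x = true then (1 : ℝ) else 0) - (ε : ℝ)) hdep
  rw [integral_bernoulli_centered, zero_mul] at hmul
  have hdepM2 : DependsOn (fun b => (∑ n ∈ Finset.range N, rewardNoise a ψ ε b n) ^ 2)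
      (Set.Iio N) := by
    intro b b' h
    have h2 := hM h
    simp only at h2
    simp only [h2]
  have hdepD2 : DependsOn (fun b => rewardNoise a ψ ε b N ^ 2) (Set.Iio (N + 1)) := by
    intro b b' h
    have h2 := dependsOn_rewardNoise (a := a) (ψ := ψ) (ε := ε) N h
    simp only at h2
    simp only [h2]
  have hdepC : DependsOn (fun b : ℕ → Bool => ((if b N = true then (1 : ℝ) else 0) - (ε : ℝ)) *
      (2 * (erasureReward a ψ b N + (a - ψ (N + 1))) *
        ∑ n ∈ Finset.range N, rewardNoise a ψ ε b n)) (Set.Iio (N + 1)) := by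
    intro b b' h
    have h1 := hdep (fun i hi => h i (lt_trans hi (Nat.lt_succ_self N)))
    have h2 := h N (Nat.lt_succ_self N)
    simp only at h1
    simp only [h1, h2]
  have hi1 := integrable_of_dependsOn (erasureLaw ε) hdepM2
  have hi2 := integrable_of_dependsOn (erasureLaw ε) hdepD2
  have hi3 := integrable_of_dependsOn (erasureLaw ε) hdepC
  have e : ∀ b : ℕ → Bool, (∑ n ∈ Finset.range (N + 1), rewardNoise a ψ ε b n) ^ 2 =
      ((∑ n ∈ Finset.range N, rewardNoise a ψ ε b n) ^ 2 + rewardNoise a ψ ε b N ^ 2) +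
      ((if b N = true then (1 : ℝ) else 0) - (ε : ℝ)) *
        (2 * (erasureReward a ψ b N + (a - ψ (N + 1))) *
          ∑ n ∈ Finset.range N, rewardNoise a ψ ε b n) := by
    intro b
    have : rewardNoise a ψ ε b N = ((if b N = true then 1 else 0) - (ε : ℝ)) *
      (erasureReward a ψ b N + (a - ψ (N + 1))) := rfl
    rw [Finset.sum_range_succ, this]
    ring
  simp_rw [e]
  have hi12 : Integrable (fun b => (∑ n ∈ Finset.range N, rewardNoise a ψ ε b n) ^ 2 +
    rewardNoise a ψ ε b N ^ 2) (erasureLaw ε) := hi1.add hi2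
  rw [integral_add hi12 hi3, hmul, add_zero, integral_add hi1 hi2]

lemma integral_rewardNoise_sq_le {C : ℝ} (ha : 0 ≤ a) (hψ : ∀ n, 0 ≤ ψ n) (hB : ∀ n, ψ n ≤ B)
    {n : ℕ} (hC : ∫ b, erasureReward a ψ b n ^ 2 ∂(erasureLaw ε) ≤ C) :
    ∫ b, rewardNoise a ψ ε b n ^ 2 ∂(erasureLaw ε) ≤ 2 * C + 2 * (a + B) ^ 2 := by
  have hdep2 : DependsOn (fun b => erasureReward a ψ b n ^ 2) (Set.Iio n) := by
    intro b b' h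
    have := dependsOn_erasureReward a ψ n h
    simp only at this
    simp only [this]
  have hdepD2 : DependsOn (fun b => rewardNoise a ψ ε b n ^ 2) (Set.Iio (n + 1)) := by
    intro b b' h
    have h2 := dependsOn_rewardNoise (a := a) (ψ := ψ) (ε := ε) n h
    simp only at h2
    simp only [h2]
  have hi2 := integrable_of_dependsOn (erasureLaw ε) hdep2
  calc ∫ b, rewardNoise a ψ ε b n ^ 2 ∂(erasureLaw ε)
      ≤ ∫ b, (2 * erasureReward a ψ b n ^ 2 + 2 * (a + B) ^ 2) ∂(erasureLaw ε) := by
        refine integral_mono (integrable_of_dependsOn (erasureLaw ε) hdepD2)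
          ((hi2.const_mul _).add (integrable_const _)) fun b => ?_
        simp only [rewardNoise, mul_pow]
        set x := erasureReward a ψ b n
        have h1 : ((if b n = true then 1 else 0) - (ε : ℝ)) ^ 2 ≤ 1 := by
          have h0 := ε.2.1
          have h1 := ε.2.2
          split_ifs <;> nlinarith
        have h2 : (a - ψ (n + 1)) ^ 2 ≤ (a + B) ^ 2 := by
          have := hψ (n + 1)
          have := hB (n + 1)
          apply sq_le_sq'  <;> linarith
        calc _ ≤ 1 * (x + (a - ψ (n + 1))) ^ 2 := by gcongr
          _ ≤ 2 * x ^ 2 + 2 * (a + B) ^ 2 := by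
            nlinarith [sq_nonneg (x - (a - ψ (n + 1)))]
    _ ≤ _ := by
        rw [integral_add (hi2.const_mul _) (integrable_const _), integral_const_mul]
        simp only [integral_const, probReal_univ, one_smul]
        linarith

/-- The noise accumulated up to the `N`-th use, less the reward at that use, grows like `√N` in
mean square. -/
lemma exists_integral_residual_sq_le (hε : (ε : ℝ) < 1) (ha : 0 ≤ a) (hψ : ∀ n, 0 ≤ ψ n)
    (hB : ∀ n, ψ n ≤ B) :
    ∃ C : ℝ, 0 ≤ C ∧ ∀ N : ℕ, ∫ b, (∑ n ∈ Finset.range N, rewardNoise a ψ ε b n -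
      erasureReward a ψ b N) ^ 2 ∂(erasureLaw ε) ≤ C * (N + 1) := by
  obtain ⟨C, hC0, hC⟩ := exists_integral_erasureReward_sq_le (a := a) hε hψ hB
  have hM : ∀ N : ℕ, ∫ b, (∑ n ∈ Finset.range N, rewardNoise a ψ ε b n) ^ 2 ∂(erasureLaw ε) ≤
      (2 * C + 2 * (a + B) ^ 2) * N := by
    intro N
    induction N with
    | zero => simp
    | succ N ih =>
      rw [integral_sum_rewardNoise_sq_succ]
      have := integral_rewardNoise_sq_le ha hψ hB (hC N)
      push_cast
      linarith
  refine ⟨4 * C + 4 * (a + B) ^ 2, by positivity, fun N => ?_⟩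
  have hdM : DependsOn (fun b => (∑ n ∈ Finset.range N, rewardNoise a ψ ε b n) ^ 2)
      (Set.Iio N) := by
    intro b b' h
    have h2 := dependsOn_sum_rewardNoise (a := a) (ψ := ψ) (ε := ε) N h
    simp only at h2
    simp only [h2]
  have hdX : DependsOn (fun b => erasureReward a ψ b N ^ 2) (Set.Iio N) := by
    intro b b' h
    have := dependsOn_erasureReward a ψ N h
    simp only at this
    simp only [this]
  have hdW : DependsOn (fun b => (∑ n ∈ Finset.range N, rewardNoise a ψ ε b n -
      erasureReward a ψ b N) ^ 2) (Set.Iio N) := by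
    intro b b' h
    have h1 := dependsOn_erasureReward a ψ N h
    have h2 := dependsOn_sum_rewardNoise (a := a) (ψ := ψ) (ε := ε) N h
    simp only at h1 h2
    simp only [h1, h2]
  have hiM := integrable_of_dependsOn (erasureLaw ε) hdM
  have hiX := integrable_of_dependsOn (erasureLaw ε) hdX
  have hiW := integrable_of_dependsOn (erasureLaw ε) hdW
  have h1 := integral_mono hiW ((hiM.const_mul 2).add (hiX.const_mul 2)) fun b => by
    simp only [Pi.add_apply]
    nlinarith [sq_nonneg (∑ n ∈ Finset.range N, rewardNoise a ψ ε b n + erasureReward a ψ b N)]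
  simp only [Pi.add_apply] at h1
  rw [integral_add (hiM.const_mul 2) (hiX.const_mul 2), integral_const_mul,
    integral_const_mul] at h1
  have hN : (0 : ℝ) ≤ N := N.cast_nonneg
  nlinarith [hM N, hC N, mul_nonneg hC0 hN, mul_nonneg (sq_nonneg (a + B)) hN,
    sq_nonneg (a + B)]

/-- The strong law of large numbers for the reward. -/
theorem ae_tendsto_average_erasureReward (hε : (ε : ℝ) < 1) (ha : 0 ≤ a) (hψ : ∀ n, 0 ≤ ψ n)
    (hB : ∀ n, ψ n ≤ B) {L : ℝ}
    (hL : Tendsto (fun N : ℕ => (∑ n ∈ Finset.range N, ψ n) / N) atTop (𝓝 L)) :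
    ∀ᵐ b ∂(erasureLaw ε), Tendsto
      (fun N : ℕ => (∑ n ∈ Finset.range N, erasureReward a ψ b n) / N) atTop
      (𝓝 (a * ε / (1 - ε) + L)) := by
  have hr : (0 : ℝ) < 1 - ε := by linarith
  obtain ⟨C, hC0, hC⟩ := exists_integral_residual_sq_le (a := a) hε ha hψ hB
  set W : ℕ → (ℕ → Bool) → ℝ := fun N b => ∑ n ∈ Finset.range N, rewardNoise a ψ ε b n -
      erasureReward a ψ b N with hW
  have hdW : ∀ N, DependsOn (W N) (Set.Iio N) := by
    intro N b b' h
    have h1 := dependsOn_erasureReward a ψ N h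
    have h2 := dependsOn_sum_rewardNoise (a := a) (ψ := ψ) (ε := ε) N h
    simp only at h1 h2
    simp only [hW, h1, h2]
  have hdY : ∀ N, DependsOn (fun b => W N b / N) (Set.Iio N) := fun N b b' h => by
    have := hdW N h
    simp only [this]
  have hdY2 : ∀ N, DependsOn (fun b => (W N b / N) ^ 2) (Set.Iio N) := fun N b b' h => by
    have := hdW N h
    simp only [this]
  -- At N = (k+1)² the second moment of W/N is at most C(N+1)/N² ≤ 2C/(k+1)². Nonnegativity of the
  -- reward fills the gaps between squares.
  have hs : Summable fun k : ℕ =>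
      ∫ b, (W ((k + 1) ^ 2) b / ((k + 1) ^ 2 : ℕ)) ^ 2 ∂(erasureLaw ε) := by
    have hs2 : Summable fun k : ℕ => 2 * C * (1 / ((k : ℝ) + 1) ^ 2) := by
      have := (summable_nat_add_iff 1).2 (Real.summable_one_div_nat_pow.2 (one_lt_two))
      simpa using this.mul_left (2 * C)
    refine hs2.of_nonneg_of_le (fun k => integral_nonneg fun b => sq_nonneg _) fun k => ?_
    simp_rw [div_pow]
    rw [integral_div, div_le_iff₀ (by positivity)]
    refine (hC _).trans ?_
    push_cast
    have hk : (0 : ℝ) < (k : ℝ) + 1 := by positivity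
    have e : 2 * C * (1 / ((k : ℝ) + 1) ^ 2) * (((k : ℝ) + 1) ^ 2) ^ 2 =
        C * (2 * ((k : ℝ) + 1) ^ 2) := by
      field_simp
    rw [e]
    have : (1 : ℝ) ≤ ((k : ℝ) + 1) ^ 2 := by nlinarith [k.cast_nonneg (α := ℝ)]
    gcongr
    linarith
  have hae := ae_tendsto_zero_of_summable_integral_sq
    (Y := fun (k : ℕ) b => W ((k + 1) ^ 2) b / ((k + 1) ^ 2 : ℕ))
    (fun k => measurable_of_dependsOn (hdY ((k + 1) ^ 2)))
    (fun k => integrable_of_dependsOn (erasureLaw ε) (hdY2 ((k + 1) ^ 2))) hs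
  filter_upwards [hae] with b hb
  refine tendsto_average_of_tendsto_squares (erasureReward_nonneg ha hψ b) ?_
  have hc : Tendsto (fun k : ℕ => (k + 1) ^ 2) atTop atTop :=
    (tendsto_pow_atTop (by norm_num)).comp (tendsto_add_atTop_nat 1)
  have hψN : Tendsto (fun N : ℕ => ψ N / N) atTop (𝓝 0) := by
    refine squeeze_zero (fun N => div_nonneg (hψ N) N.cast_nonneg)
      (fun N => div_le_div_of_nonneg_right (hB N) N.cast_nonneg) ?_
    exact tendsto_const_div_atTop_nhds_zero_nat B
  have hdet : Tendsto (fun N : ℕ => ε * a + (1 - ε) * ((∑ n ∈ Finset.range N, ψ n) / N +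
      ψ N / N) + (ε * ψ 0) / N) atTop (𝓝 (ε * a + (1 - ε) * (L + 0) + 0)) :=
    ((((hL.add hψN).const_mul _).const_add _).add (tendsto_const_div_atTop_nhds_zero_nat _))
  have hlim := (((hdet.comp hc).add hb).div_const (1 - (ε : ℝ)))
  have hval : (ε * a + (1 - ε) * (L + 0) + 0 + 0) / (1 - (ε : ℝ)) = a * ε / (1 - ε) + L := by
    field_simp
    ring
  rw [hval] at hlim
  refine hlim.congr fun k => ?_
  have hk : (((k + 1) ^ 2 : ℕ) : ℝ) ≠ 0 := by positivity
  have h := sum_erasureReward (a := a) (ψ := ψ) (ε := ε) b ((k + 1) ^ 2)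
  simp only [Function.comp_apply]
  rw [div_eq_iff hr.ne']
  have h' : (1 - (ε : ℝ)) * (∑ n ∈ Finset.range ((k + 1) ^ 2), erasureReward a ψ b n) =
    ε * a * ((k + 1) ^ 2 : ℕ) + (1 - ε) * (∑ n ∈ Finset.range ((k + 1) ^ 2), ψ n +
      ψ ((k + 1) ^ 2) - ψ 0) + ψ 0 + W ((k + 1) ^ 2) b := h
  have e2 : (∑ n ∈ Finset.range ((k + 1) ^ 2), erasureReward a ψ b n) /
      (((k + 1) ^ 2 : ℕ) : ℝ) * (1 - ε) = ((1 - (ε : ℝ)) *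
      (∑ n ∈ Finset.range ((k + 1) ^ 2), erasureReward a ψ b n)) / (((k + 1) ^ 2 : ℕ) : ℝ) := by
    ring
  rw [e2, h']
  field_simp
  ring

end Reward

/-! ### The last reception, the uncoded scheme and the converse -/

lemma numGenerated_mono {ρ : ℝ} (hρ : 0 ≤ ρ) : Monotone (numGenerated ρ) := fun i j hij => by
  unfold numGenerated
  gcongr

/-- The last non-erased channel use among the first `n` ones (counted from `1`), or `0`. -/
def lastReceived (b : ℕ → Bool) : ℕ → ℕ
  | 0 => 0
  | n + 1 => if b n = true then lastReceived b n else n + 1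

lemma lastReceived_le (b : ℕ → Bool) (n : ℕ) : lastReceived b n ≤ n := by
  induction n with
  | zero => exact le_rfl
  | succ n ih =>
    rw [lastReceived]
    split_ifs <;> omega

lemma lastReceived_mono (b : ℕ → Bool) : Monotone (lastReceived b) :=
  monotone_nat_of_le_succ fun n => by
    have := lastReceived_le b n
    rw [lastReceived]
    split_ifs <;> omega

lemma le_lastReceived {b : ℕ → Bool} {k n : ℕ} (hk : k < n) (hb : b k ≠ true) :
    k + 1 ≤ lastReceived b n := by
  have : lastReceived b (k + 1) = k + 1 := by rw [lastReceived, if_neg hb]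
  rw [← this]
  exact lastReceived_mono b hk

lemma dependsOn_lastReceived (n : ℕ) : DependsOn (fun b => lastReceived b n) (Set.Iio n) := by
  induction n with
  | zero => intro b b' _; rfl
  | succ n ih =>
    intro b b' h
    have h1 := ih (fun i hi => h i (lt_trans hi (Nat.lt_succ_self n)))
    have h2 := h n (Nat.lt_succ_self n)
    simp only at h1
    simp only [lastReceived, h1, h2]

namespace CodingScheme

variable {U V : Type*} {ρ : ℝ}

/-- The scheme which always sends the freshest symbol, uncoded. -/
noncomputable def uncoded [Nonempty V] (σ : U ≃ V) (ρ : ℝ) : CodingScheme U V ρ where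
  enc i x := if h : 0 < numGenerated ρ i then σ (x ⟨numGenerated ρ i - 1, by omega⟩)
    else Classical.arbitrary V
  dec
    | 0 => fun _ => none
    | i + 1 => fun y => if h : 0 < numGenerated ρ (i + 1) then
        (y (Fin.last i)).map fun v => (σ.symm v, ⟨numGenerated ρ (i + 1) - 1, by omega⟩)
      else none

section Uncoded

variable [Nonempty V] (σ : U ≃ V)

lemma output_uncoded_succ (ω : Sample U) (i : ℕ) :
    (uncoded σ ρ).output ω (i + 1) =
      if h : 0 < numGenerated ρ (i + 1) then
        if ω.2 i = true then none else
          some (ω.1 (numGenerated ρ (i + 1) - 1), ⟨numGenerated ρ (i + 1) - 1, by omega⟩)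
      else none := by
  unfold output received
  by_cases h : 0 < numGenerated ρ (i + 1)
  · by_cases hb : ω.2 i = true
    · simp [uncoded, h, hb]
    · simp [uncoded, h, hb]
  · simp [uncoded, h]

lemma output_uncoded_correct (ω : Sample U) (i : ℕ) (u : U) (j : Fin (numGenerated ρ i))
    (h : (uncoded σ ρ).output ω i = some (u, j)) : u = ω.1 j := by
  cases i with
  | zero => simp [output, uncoded] at h
  | succ i =>
    rw [output_uncoded_succ] at h
    split_ifs at h
    simp only [Option.some.injEq, Prod.mk.injEq] at h
    obtain ⟨rfl, rfl⟩ := h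
    rfl

lemma decodedIndex_uncoded_succ (ω : Sample U) (i : ℕ) :
    (uncoded σ ρ).decodedIndex ω (i + 1) =
      if ω.2 i = true then 0 else numGenerated ρ (i + 1) := by
  unfold decodedIndex
  rw [output_uncoded_succ]
  by_cases h : 0 < numGenerated ρ (i + 1)
  · by_cases hb : ω.2 i = true
    · simp [hb]
    · simp only [h, hb, dif_pos, if_neg, Bool.false_eq_true, not_false_eq_true]
      omega
  · have : numGenerated ρ (i + 1) = 0 := by omega
    simp [this]

lemma freshestIndex_uncoded (hρ : 0 ≤ ρ) (ω : Sample U) (n : ℕ) :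
    (uncoded σ ρ).freshestIndex ω n = numGenerated ρ (lastReceived ω.2 n) := by
  unfold freshestIndex
  induction n with
  | zero => simp [lastReceived, numGenerated]
  | succ n ih =>
    rw [← Finset.insert_Icc_right_eq_Icc_add_one (by omega), Finset.sup_insert, ih,
      decodedIndex_uncoded_succ, lastReceived]
    split_ifs
    · simp
    · exact sup_eq_left.2 (numGenerated_mono hρ ((lastReceived_le _ n).trans n.le_succ))

end Uncoded

/-- For a fixed pattern, erased outputs carry no source symbol, and all others were sent no later
than the last reception. -/
lemma dependsOn_dec (hρ : 0 ≤ ρ) (C : CodingScheme U V ρ) (b : ℕ → Bool) (i : ℕ) :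
    DependsOn (fun u : ℕ → U => C.output (u, b) i)
      (Set.Iio (numGenerated ρ (lastReceived b i))) := by
  intro u u' h
  refine congrArg (C.dec i) (funext fun k => ?_)
  unfold received
  by_cases hb : b k = true
  · simp [hb]
  · simp only [hb, if_false, Bool.false_eq_true]
    congr 2
    funext j
    refine h j (lt_of_lt_of_le j.2 (numGenerated_mono hρ ?_))
    exact le_lastReceived k.2 hb

variable [Finite U] [MeasurableSpace U] [MeasurableSingletonClass U]

/-- A zero-error decoder never puts out a symbol generated after the last non-erased use. -/
lemma measure_output_eq_zero (hρ : 0 ≤ ρ) (p : Measure U) [IsProbabilityMeasure p]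
    (hp : ∀ u : U, p {u} ≠ 1) (ε : unitInterval) (C : CodingScheme U V ρ)
    (hC : C.ZeroError p ε) {i : ℕ} (hi : 1 ≤ i) (v : U) (j : Fin (numGenerated ρ i)) :
    systemLaw p ε {ω | C.output ω i = some (v, j) ∧
      numGenerated ρ (lastReceived ω.2 i) ≤ j} = 0 := by
  set b₀ : (Fin i → Bool) → ℕ → Bool := fun s k => if h : k < i then s ⟨k, h⟩ else true with hb₀
  have hprefix : ∀ b : ℕ → Bool, ∀ k < i, b₀ (fun k => b k) k = b k := by
    intro b k hk
    simp [hb₀, hk]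
  have hout : ∀ (u : ℕ → U) (b b' : ℕ → Bool), (∀ k < i, b k = b' k) →
      C.output (u, b) i = C.output (u, b') i := by
    intro u b b' h
    unfold output received
    congr 1
    funext k
    simp only [h k k.2]
  -- Only the first i erasures matter, so the event is covered by finitely many rectangles, one per
  -- finite pattern; the value of `b₀ s` beyond i is immaterial.
  have hsub : {ω : Sample U | C.output ω i = some (v, j) ∧
      numGenerated ρ (lastReceived ω.2 i) ≤ j} ⊆
      ⋃ s ∈ {s : Fin i → Bool | numGenerated ρ (lastReceived (b₀ s) i) ≤ j},
        {u : ℕ → U | C.output (u, b₀ s) i = some (v, j)} ×ˢ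
          {b : ℕ → Bool | ∀ k < i, b k = b₀ s k} := by
    rintro ⟨u, b⟩ ⟨h1, h2⟩
    simp only [Set.mem_iUnion]
    have hl := dependsOn_lastReceived i (fun k hk => hprefix b k hk)
    simp only at hl h2
    refine ⟨fun k => b k, ?_, ?_, ?_⟩
    · simp only [Set.mem_ofPred_eq]
      rw [hl]
      exact h2
    · simp only [Set.mem_ofPred_eq]
      rw [hout u _ b (hprefix b)]
      exact h1
    · intro k hk
      exact (hprefix b k hk).symm
  refine measure_mono_null hsub ?_
  rw [measure_biUnion_null_iff (Set.to_countable _)]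
  intro s hs
  simp only [Set.mem_ofPred_eq] at hs
  set G := {u : ℕ → U | C.output (u, b₀ s) i = some (v, j)} with hG
  have hdep : DependsOn (fun u : ℕ → U => C.output (u, b₀ s) i = some (v, j))
      (Set.Iio (j : ℕ)) := by
    intro u u' h
    have := dependsOn_dec hρ C (b₀ s) i (fun k hk => h k (lt_of_lt_of_le hk hs))
    simp only at this
    simp only [this]
  have hind := (indepFun_eval_of_dependsOn p hdep).measure_inter_preimage_eq_mul
    {v}ᶜ {True} (measurableSet_singleton v).compl (measurableSet_singleton True)
  have hGe : (fun u : ℕ → U => C.output (u, b₀ s) i = some (v, j)) ⁻¹' {True} = G := by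
    ext u
    simp [hG]
  have hev : (Measure.infinitePi fun _ : ℕ => p) ((fun u : ℕ → U => u j) ⁻¹' {v}ᶜ) = p {v}ᶜ :=
    (measurePreserving_eval_infinitePi (fun _ : ℕ => p) (j : ℕ)).measure_preimage
      (measurableSet_singleton v).compl.nullMeasurableSet
  rw [hGe, hev] at hind
  have hpv : p {v}ᶜ ≠ 0 := by
    rw [Ne, prob_compl_eq_zero_iff (measurableSet_singleton v)]
    exact hp v
  -- Here the estimate v is wrong, so zero error makes this set null. By independence its measure is
  -- that of the full rectangle times `p {v}ᶜ`, which is not 0; hence the rectangle is null.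
  have hnull : systemLaw p ε (((fun u : ℕ → U => u j) ⁻¹' {v}ᶜ ∩ G) ×ˢ
      {b : ℕ → Bool | ∀ k < i, b k = b₀ s k}) = 0 := by
    refine measure_mono_null ?_ hC
    rintro ⟨u, b⟩ ⟨⟨h1, h2⟩, h3⟩ hgood
    refine h1 (hgood i hi v j ?_).symm
    rw [hout u b (b₀ s) h3]
    exact h2
  unfold systemLaw at hnull ⊢
  rw [Measure.prod_prod, hind, mul_eq_zero, mul_eq_zero] at hnull
  rw [Measure.prod_prod, mul_eq_zero]
  tauto

lemma ae_freshestIndex_le (hρ : 0 ≤ ρ) (p : Measure U) [IsProbabilityMeasure p]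
    (hp : ∀ u : U, p {u} ≠ 1) (ε : unitInterval) (C : CodingScheme U V ρ)
    (hC : C.ZeroError p ε) :
    ∀ᵐ ω ∂(systemLaw p ε), ∀ n,
      C.freshestIndex ω n ≤ numGenerated ρ (lastReceived ω.2 n) := by
  have h : ∀ᵐ ω ∂(systemLaw p ε), ∀ i : ℕ, 1 ≤ i → ∀ (v : U) (j : Fin (numGenerated ρ i)),
      ¬ (C.output ω i = some (v, j) ∧ numGenerated ρ (lastReceived ω.2 i) ≤ j) := by
    have : Countable U := Finite.to_countable
    simp only [ae_all_iff]
    intro i hi v j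
    have := measure_output_eq_zero hρ p hp ε C hC hi v j
    rw [ae_iff]
    simpa only [not_not] using this
  filter_upwards [h] with ω hω n
  refine Finset.sup_le fun i hi => ?_
  rw [Finset.mem_Icc] at hi
  refine le_trans ?_ (numGenerated_mono hρ (lastReceived_mono ω.2 hi.2))
  unfold decodedIndex
  split
  · exact Nat.zero_le _
  · rename_i v j hvj
    by_contra hlt
    exact hω i hi.1 v j ⟨hvj, by omega⟩

end CodingScheme

/-! ### Time average of the freshest age -/

/-- The age when the freshest symbol is delivered at each non-erased channel use. -/
noncomputable def freshestAge (lam mu : ℝ) (b : ℕ → Bool) (t : ℝ) : ℝ :=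
  t - (numGenerated (lam / mu) (lastReceived b ⌊t * mu⌋₊) : ℝ) / lam

lemma intervalIntegrable_sub_step {mu : ℝ} (hmu : 0 ≤ mu) {F : ℕ → ℕ} (hF : Monotone F)
    {lam : ℝ} (hlam : 0 ≤ lam) (x y : ℝ) :
    IntervalIntegrable (fun t : ℝ => t - (F ⌊t * mu⌋₊ : ℝ) / lam) volume x y := by
  refine continuous_id.intervalIntegrable x y |>.sub (Monotone.intervalIntegrable ?_)
  intro s t hst
  have h : F ⌊s * mu⌋₊ ≤ F ⌊t * mu⌋₊ := hF (Nat.floor_mono (by gcongr))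
  have h' : (F ⌊s * mu⌋₊ : ℝ) ≤ F ⌊t * mu⌋₊ := by exact_mod_cast h
  simp only
  gcongr

section FreshestAge

variable {lam mu : ℝ}

lemma intervalIntegrable_freshestAge (hlam : 0 < lam) (hmu : 0 < mu) (b : ℕ → Bool) (x y : ℝ) :
    IntervalIntegrable (freshestAge lam mu b) volume x y :=
  intervalIntegrable_sub_step hmu.le
    ((numGenerated_mono (div_pos hlam hmu).le).comp (lastReceived_mono b)) hlam.le x y

lemma numGenerated_eq_sub_fract (hlam : 0 < lam) (hmu : 0 < mu) (k : ℕ) :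
    (numGenerated (lam / mu) k : ℝ) / lam = k / mu - Int.fract ((k : ℝ) * (lam / mu)) / lam := by
  have h0 : 0 ≤ (k : ℝ) * (lam / mu) := by positivity
  unfold numGenerated
  rw [natCast_floor_eq_intCast_floor h0, ← Int.self_sub_fract]
  field_simp

lemma freshestAge_nonneg (hlam : 0 < lam) (hmu : 0 < mu) (b : ℕ → Bool) {t : ℝ} (ht : 0 ≤ t) :
    0 ≤ freshestAge lam mu b t := by
  unfold freshestAge
  rw [numGenerated_eq_sub_fract hlam hmu]
  have h1 : 0 ≤ Int.fract ((lastReceived b ⌊t * mu⌋₊ : ℝ) * (lam / mu)) / lam :=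
    div_nonneg (Int.fract_nonneg _) hlam.le
  have h2 : (lastReceived b ⌊t * mu⌋₊ : ℝ) / mu ≤ t := by
    rw [div_le_iff₀ hmu]
    have : (lastReceived b ⌊t * mu⌋₊ : ℝ) ≤ (⌊t * mu⌋₊ : ℝ) := by
      exact_mod_cast lastReceived_le b _
    exact this.trans (Nat.floor_le (by positivity))
  linarith

/-- Every use since the last reception was an erasure and added one period 1/μ. -/
lemma erasureReward_eq (hmu : 0 < mu) (ψ : ℕ → ℝ) (b : ℕ → Bool) (n : ℕ) :
    erasureReward (1 / mu) ψ b n =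
      ((n : ℝ) - lastReceived b n) / mu + ψ (lastReceived b n) := by
  induction n with
  | zero => simp [erasureReward, lastReceived]
  | succ n ih =>
    rw [erasureReward, lastReceived]
    split_ifs
    · rw [ih]
      push_cast
      field_simp
      ring
    · simp

/-- The delay of the source symbol generated last before the `n`-th channel use. -/
noncomputable def generationDelay (lam mu : ℝ) (n : ℕ) : ℝ :=
  Int.fract ((n : ℝ) * (lam / mu)) / lam

lemma freshestAge_eq (hlam : 0 < lam) (hmu : 0 < mu) (b : ℕ → Bool) {n : ℕ} {t : ℝ}
    (h1 : (n : ℝ) / mu < t) (h2 : t < ((n + 1 : ℕ) : ℝ) / mu) :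
    freshestAge lam mu b t =
      erasureReward (1 / mu) (generationDelay lam mu) b n + (t - n / mu) := by
  have hfl : ⌊t * mu⌋₊ = n := by
    rw [div_lt_iff₀ hmu] at h1
    rw [lt_div_iff₀ hmu] at h2
    push_cast at h2
    exact (Nat.floor_eq_iff (n.cast_nonneg.trans h1.le)).2 ⟨h1.le, h2⟩
  unfold freshestAge
  rw [hfl, numGenerated_eq_sub_fract hlam hmu, erasureReward_eq hmu, generationDelay]
  ring

/-- Between uses the age rises with slope 1 from the reward, adding a triangle of area 1/(2μ²) per
period. -/
lemma integral_freshestAge (hlam : 0 < lam) (hmu : 0 < mu) (b : ℕ → Bool) (N : ℕ) :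
    ∫ t in (0 : ℝ)..(N / mu), freshestAge lam mu b t =
      (∑ n ∈ Finset.range N, erasureReward (1 / mu) (generationDelay lam mu) b n) / mu +
        N / (2 * mu ^ 2) := by
  have hsum := intervalIntegral.sum_integral_adjacent_intervals (μ := volume)
    (f := freshestAge lam mu b) (a := fun n : ℕ => (n : ℝ) / mu) (n := N)
    (fun k _ => intervalIntegrable_freshestAge hlam hmu b _ _)
  simp only [Nat.cast_zero, zero_div] at hsum
  rw [← hsum]
  have hterm : ∀ n ∈ Finset.range N,
      ∫ t in ((n : ℝ) / mu)..(((n + 1 : ℕ) : ℝ) / mu), freshestAge lam mu b t =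
        erasureReward (1 / mu) (generationDelay lam mu) b n / mu + 1 / (2 * mu ^ 2) := by
    intro n _
    have hle : (n : ℝ) / mu ≤ ((n + 1 : ℕ) : ℝ) / mu := by
      push_cast
      gcongr
      linarith
    -- The open interval avoids the possible jump at the right endpoint.
    rw [intervalIntegral.integral_congr_Ioo_of_le hle fun t ht =>
      freshestAge_eq hlam hmu b ht.1 ht.2]
    rw [intervalIntegral.integral_add (by simp) (by
      exact (continuous_id.sub continuous_const).intervalIntegrable _ _),
      intervalIntegral.integral_sub (by exact continuous_id.intervalIntegrable _ _) (by simp),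
      integral_id]
    simp only [intervalIntegral.integral_const, smul_eq_mul]
    push_cast
    field_simp
    ring
  rw [Finset.sum_congr rfl hterm, Finset.sum_add_distrib, Finset.sum_div]
  simp only [Finset.sum_const, Finset.card_range, nsmul_eq_mul]
  ring

end FreshestAge

/-- The time average of a nonnegative function converges if it does along a regular grid. -/
lemma tendsto_timeAverage_of_grid {f : ℝ → ℝ} {mu L : ℝ} (hmu : 0 < mu)
    (hint : ∀ x y, IntervalIntegrable f volume x y) (hf : ∀ t, 0 ≤ t → 0 ≤ f t)
    (h : Tendsto (fun N : ℕ => (∫ t in (0 : ℝ)..(N / mu), f t) / N) atTop (𝓝 (L / mu))) :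
    Tendsto (fun τ : ℝ => 1 / τ * ∫ t in (0 : ℝ)..τ, f t) atTop (𝓝 L) := by
  set I : ℝ → ℝ := fun τ => ∫ t in (0 : ℝ)..τ, f t with hI
  have hmono : ∀ x y, 0 ≤ x → x ≤ y → I x ≤ I y := by
    intro x y hx hxy
    have h1 : I x + ∫ t in x..y, f t = I y :=
      intervalIntegral.integral_add_adjacent_intervals (hint 0 x) (hint x y)
    have h2 : 0 ≤ ∫ t in x..y, f t :=
      intervalIntegral.integral_nonneg hxy fun t ht => hf t (hx.trans ht.1)
    linarith
  have hfloor : Tendsto (fun τ : ℝ => (⌊mu * τ⌋₊ : ℝ) / τ) atTop (𝓝 mu) :=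
    tendsto_nat_floor_mul_div_atTop hmu.le
  have hfl : Tendsto (fun τ : ℝ => ⌊mu * τ⌋₊) atTop atTop :=
    tendsto_nat_floor_atTop.comp (tendsto_id.const_mul_atTop hmu)
  have hval : L / mu * mu = L := by field_simp
  have hlow : Tendsto (fun τ : ℝ => I ((⌊mu * τ⌋₊ : ℕ) / mu) / (⌊mu * τ⌋₊ : ℕ) *
      ((⌊mu * τ⌋₊ : ℝ) / τ)) atTop (𝓝 L) := by
    have := (h.comp hfl).mul hfloor
    rwa [hval] at this
  have hceil : Tendsto (fun τ : ℝ => ((⌊mu * τ⌋₊ + 1 : ℕ) : ℝ) / τ) atTop (𝓝 mu) := by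
    have := hfloor.add (tendsto_inv_atTop_zero (𝕜 := ℝ))
    rw [add_zero] at this
    refine this.congr fun τ => ?_
    push_cast
    ring
  have hup : Tendsto (fun τ : ℝ => I ((⌊mu * τ⌋₊ + 1 : ℕ) / mu) / (⌊mu * τ⌋₊ + 1 : ℕ) *
      (((⌊mu * τ⌋₊ + 1 : ℕ) : ℝ) / τ)) atTop (𝓝 L) := by
    have := ((h.comp (tendsto_add_atTop_nat 1)).comp hfl).mul hceil
    rwa [hval] at this
  -- The integral is monotone in τ, so it lies between its values at the two neighbouring grid
  -- points.
  refine tendsto_of_tendsto_of_tendsto_of_le_of_le' hlow hup ?_ ?_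
  · filter_upwards [eventually_gt_atTop 0, hfl.eventually (eventually_gt_atTop 0)] with τ hτ hn
    have hn' : (0 : ℝ) < (⌊mu * τ⌋₊ : ℕ) := by exact_mod_cast hn
    have h1 : I ((⌊mu * τ⌋₊ : ℕ) / mu) ≤ I τ := by
      refine hmono _ _ (by positivity) ?_
      rw [div_le_iff₀ hmu, mul_comm τ]
      exact Nat.floor_le (by positivity)
    rw [div_mul_div_cancel₀ hn'.ne', one_div_mul_eq_div]
    gcongr
  · filter_upwards [eventually_gt_atTop 0] with τ hτ
    have hn' : (0 : ℝ) < ((⌊mu * τ⌋₊ + 1 : ℕ) : ℝ) := by positivity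
    have h1 : I τ ≤ I (((⌊mu * τ⌋₊ + 1 : ℕ) : ℝ) / mu) := by
      refine hmono _ _ hτ.le ?_
      rw [le_div_iff₀ hmu, mul_comm τ]
      push_cast
      exact (Nat.lt_floor_add_one _).le
    rw [div_mul_div_cancel₀ hn'.ne', one_div_mul_eq_div]
    gcongr

lemma ae_tendsto_average_freshestAge {lam mu : ℝ} (hlam : 0 < lam) (hmu : 0 < mu)
    {ε : unitInterval} (hε : (ε : ℝ) < 1) {c : ℝ}
    (hc : Tendsto (fun N : ℕ => (∑ n ∈ Finset.range N, Int.fract ((n : ℝ) * (lam / mu))) / N)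
      atTop (𝓝 c)) :
    ∀ᵐ b ∂(erasureLaw ε), Tendsto
      (fun τ : ℝ => 1 / τ * ∫ t in (0 : ℝ)..τ, freshestAge lam mu b t) atTop
      (𝓝 (c / lam + (1 + (ε : ℝ)) / (2 * mu * (1 - (ε : ℝ))))) := by
  have hψ : Tendsto (fun N : ℕ => (∑ n ∈ Finset.range N, generationDelay lam mu n) / N) atTop
      (𝓝 (c / lam)) := by
    refine (hc.div_const lam).congr fun N => ?_
    simp only [generationDelay]
    rw [← Finset.sum_div]
    ring
  have hr : (1 : ℝ) - ε ≠ 0 := by linarith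
  filter_upwards [ae_tendsto_average_erasureReward (a := 1 / mu) (B := 1 / lam)
    (ψ := generationDelay lam mu) hε
    (by positivity) (fun n => div_nonneg (Int.fract_nonneg _) hlam.le)
    (fun n => div_le_div_of_nonneg_right (Int.fract_lt_one _).le hlam.le) hψ] with b hb
  refine tendsto_timeAverage_of_grid hmu (intervalIntegrable_freshestAge hlam hmu b)
    (fun t ht => freshestAge_nonneg hlam hmu b ht) ?_
  -- This is ε/(1-ε) + 1/2 = (1+ε)/(2(1-ε)).
  have hval : (1 / mu * (ε : ℝ) / (1 - ε) + c / lam) / mu + 1 / (2 * mu ^ 2) =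
      (c / lam + (1 + (ε : ℝ)) / (2 * mu * (1 - (ε : ℝ)))) / mu := by
    field_simp
    ring
  rw [← hval]
  refine ((hb.div_const mu).add_const (1 / (2 * mu ^ 2))).congr' ?_
  filter_upwards [eventually_gt_atTop 0] with N hN
  have hN' : (N : ℝ) ≠ 0 := by positivity
  rw [integral_freshestAge hlam hmu]
  field_simp

/-! ### Comparison of schemes and the optimal age -/

namespace CodingScheme

variable {U V : Type*} {lam mu : ℝ}

lemma age_uncoded [Nonempty V] (σ : U ≃ V) (hlam : 0 < lam) (hmu : 0 < mu) (ω : Sample U) :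
    (uncoded σ (lam / mu)).age ω = freshestAge lam mu ω.2 := by
  funext t
  unfold age freshestAge
  rw [freshestIndex_uncoded σ (div_pos hlam hmu).le]

lemma freshestIndex_mono (C : CodingScheme U V (lam / mu)) (ω : Sample U) :
    Monotone (C.freshestIndex ω) := fun _ _ h =>
  Finset.sup_mono (Finset.Icc_subset_Icc_right h)

lemma timeAverage_ge (hlam : 0 < lam) (hmu : 0 < mu) (C : CodingScheme U V (lam / mu))
    {ω : Sample U}
    (h : ∀ n, C.freshestIndex ω n ≤ numGenerated (lam / mu) (lastReceived ω.2 n))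
    {τ : ℝ} (hτ : 0 < τ) :
    1 / τ * ∫ t in (0 : ℝ)..τ, freshestAge lam mu ω.2 t ≤ C.timeAverage ω τ := by
  unfold timeAverage
  gcongr
  refine intervalIntegral.integral_mono_on hτ.le (intervalIntegrable_freshestAge hlam hmu _ _ _)
    (intervalIntegrable_sub_step hmu.le (C.freshestIndex_mono ω) hlam.le _ _) fun t _ => ?_
  have : (C.freshestIndex ω ⌊t * mu⌋₊ : ℝ) ≤
      numGenerated (lam / mu) (lastReceived ω.2 ⌊t * mu⌋₊) := by exact_mod_cast h _
  unfold freshestAge age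
  gcongr

end CodingScheme

/-- The optimal average age in terms of the mean of the fractional parts `{n λ / μ}`. -/
theorem optimalAverageAge_of_tendsto {U V : Type*} [Fintype U] [Fintype V]
    (hUV : Fintype.card U = Fintype.card V)
    [MeasurableSpace U] [MeasurableSingletonClass U]
    (p : Measure U) [IsProbabilityMeasure p] (hp : ∀ u : U, p {u} ≠ 1)
    (ε : unitInterval) (hε : (ε : ℝ) < 1)
    (lam mu : ℝ) (hlam : 0 < lam) (hmu : 0 < mu) {c : ℝ}
    (hc : Tendsto (fun N : ℕ => (∑ n ∈ Finset.range N, Int.fract ((n : ℝ) * (lam / mu))) / N)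
      atTop (𝓝 c)) :
    optimalAverageAge U V p ε lam mu =
        ((c / lam + (1 + (ε : ℝ)) / (2 * mu * (1 - (ε : ℝ))) : ℝ) : EReal) ∧
    (∃ C : CodingScheme U V (lam / mu),
      C.ZeroError p ε ∧ C.HasAverageAge p ε (optimalAverageAge U V p ε lam mu)) ∧
    (∀ C : CodingScheme U V (lam / mu), C.ZeroError p ε →
      ∀ᵐ ω ∂(systemLaw p ε),
        optimalAverageAge U V p ε lam mu ≤
          liminf (fun τ : ℝ => (C.timeAverage ω τ : EReal)) atTop) := by
  set A : ℝ := c / lam + (1 + (ε : ℝ)) / (2 * mu * (1 - (ε : ℝ))) with hA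
  have : IsProbabilityMeasure (systemLaw p ε) := by unfold systemLaw; infer_instance
  have hlim : ∀ᵐ ω ∂(systemLaw p ε), Tendsto (fun τ : ℝ =>
      ((1 / τ * ∫ t in (0 : ℝ)..τ, freshestAge lam mu ω.2 t : ℝ) : EReal)) atTop
      (𝓝 (A : EReal)) := by
    have h := Measure.quasiMeasurePreserving_snd (μ := Measure.infinitePi fun _ : ℕ => p)
      (ν := erasureLaw ε) |>.ae (ae_tendsto_average_freshestAge hlam hmu hε hc)
    filter_upwards [h] with ω hω
    exact EReal.tendsto_coe.2 hω
  have hlower : ∀ C : CodingScheme U V (lam / mu), C.ZeroError p ε →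
      ∀ᵐ ω ∂(systemLaw p ε),
        (A : EReal) ≤ liminf (fun τ : ℝ => (C.timeAverage ω τ : EReal)) atTop := by
    intro C hC
    filter_upwards [hlim, C.ae_freshestIndex_le (div_pos hlam hmu).le p hp ε hC] with ω h1 h2
    rw [← h1.liminf_eq]
    refine liminf_le_liminf ?_
    filter_upwards [eventually_gt_atTop 0] with τ hτ
    exact EReal.coe_le_coe_iff.2 (C.timeAverage_ge hlam hmu h2 hτ)
  have hU : Nonempty U := by
    by_contra h
    rw [not_nonempty_iff] at h
    have := measure_univ (μ := p)
    simp [Set.eq_empty_of_isEmpty] at this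
  obtain ⟨σ⟩ : Nonempty (U ≃ V) := Fintype.card_eq.1 hUV
  have : Nonempty V := σ.nonempty_congr.1 hU
  have hzero : (CodingScheme.uncoded σ (lam / mu)).ZeroError p ε :=
    Eventually.of_forall fun ω i _ u j h => CodingScheme.output_uncoded_correct σ ω i u j h
  have havg : (CodingScheme.uncoded σ (lam / mu)).HasAverageAge p ε A := by
    filter_upwards [hlim] with ω hω
    unfold CodingScheme.timeAverage
    rwa [CodingScheme.age_uncoded σ hlam hmu]
  have hopt : optimalAverageAge U V p ε lam mu = A := by
    refine le_antisymm (sInf_le ⟨_, hzero, havg⟩) (le_sInf ?_)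
    rintro a ⟨C, hC, ha⟩
    -- The claim is deterministic, so one sample point where both almost sure statements hold
    -- suffices.
    obtain ⟨ω, h1, h2⟩ := ((hlower C hC).and ha).exists
    rwa [h2.liminf_eq] at h1
  rw [hopt]
  exact ⟨rfl, ⟨_, hzero, havg⟩, hlower⟩

theorem theorem3 {U V : Type*} [Fintype U] [Fintype V]
    (hUV : Fintype.card U = Fintype.card V)
    [MeasurableSpace U] [MeasurableSingletonClass U]
    (p : Measure U) [IsProbabilityMeasure p] (hp : ∀ u : U, p {u} ≠ 1)
    (ε : unitInterval) (hε : (ε : ℝ) < 1)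
    (lam mu : ℝ) (hlam : 0 < lam) (hmu : 0 < mu) :
    -- the value for irrational utilization
    (Irrational (lam / mu) →
      optimalAverageAge U V p ε lam mu =
        ((1 / (2 * lam) + (1 + (ε : ℝ)) / (2 * mu * (1 - (ε : ℝ))) : ℝ) : EReal)) ∧
    -- the value for rational utilization
    (∀ m l : ℕ, l ≠ 0 → Nat.Coprime m l → lam / mu = (m : ℝ) / (l : ℝ) →
      optimalAverageAge U V p ε lam mu =
        ((((l : ℝ) - 1) / (2 * (l : ℝ) * lam) +
          (1 + (ε : ℝ)) / (2 * mu * (1 - (ε : ℝ))) : ℝ) : EReal)) ∧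
    -- the infimum is attained
    (∃ C : CodingScheme U V (lam / mu),
      C.ZeroError p ε ∧ C.HasAverageAge p ε (optimalAverageAge U V p ε lam mu)) ∧
    -- no scheme does better, even one whose time averages do not converge
    (∀ C : CodingScheme U V (lam / mu), C.ZeroError p ε →
      ∀ᵐ ω ∂(systemLaw p ε),
        optimalAverageAge U V p ε lam mu ≤
          liminf (fun τ : ℝ => (C.timeAverage ω τ : EReal)) atTop) := by
  have hρ : 0 < lam / mu := div_pos hlam hmu
  have main := fun (c : ℝ) hc =>
    optimalAverageAge_of_tendsto hUV p hp ε hε lam mu hlam hmu (c := c) hc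
  have hrat : ∀ m l : ℕ, l ≠ 0 → Nat.Coprime m l → lam / mu = (m : ℝ) / (l : ℝ) →
      Tendsto (fun N : ℕ => (∑ n ∈ Finset.range N, Int.fract ((n : ℝ) * (lam / mu))) / N)
        atTop (𝓝 (((l : ℝ) - 1) / (2 * l))) := by
    intro m l hl hml h
    rw [h]
    exact tendsto_average_fract_of_coprime hl hml
  -- The mean exists for every ρ, so attainment and the lower bound need no case distinction.
  have hex : ∃ c, Tendsto
      (fun N : ℕ => (∑ n ∈ Finset.range N, Int.fract ((n : ℝ) * (lam / mu))) / N) atTop (𝓝 c) := by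
    by_cases hirr : Irrational (lam / mu)
    · exact ⟨_, tendsto_average_fract_of_irrational hirr⟩
    · obtain ⟨r, hr⟩ := not_not.1 hirr
      have hr0 : 0 ≤ r := by
        have : (0 : ℝ) ≤ r := hr ▸ hρ.le
        exact_mod_cast this
      refine ⟨_, hrat r.num.natAbs r.den r.den_ne_zero r.reduced ?_⟩
      rw [← hr, Nat.cast_natAbs, abs_of_nonneg (Rat.num_nonneg.2 hr0)]
      exact_mod_cast (Rat.num_div_den r).symm
  obtain ⟨c, hc⟩ := hex
  refine ⟨fun hirr => ?_, fun m l hl hml h => ?_, (main c hc).2⟩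
  · rw [(main _ (tendsto_average_fract_of_irrational hirr)).1, div_div]
  · rw [(main _ (hrat m l hl hml h)).1, div_div]
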